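/- Let $p\in(0,1]$ and let $\mu$ be a probability measure on $\mathbb{N}=\{0,1,2,\dots\}$ with full support, i.e. $\mu_k:=\mu(\{k\})>0$ for every $k$. Write $\mu[n,\infty)=\mu(\{n,n+1,\dots\})$ and $Df(k)=f(k+1)-f(k)$. Let \[ \mathcal{E}(f,g)=\sum_{k\ge 0}Df(k)\,Dg(k)\,\mu_k ,\qquad f,g\in\mathcal{H}:=\Bigl\{h\in L_2(\mu):\ \sum_{k\ge0}(Dh(k))^2\mu_k<\infty\Bigr\}, \] be the birth–death Dirichlet form, let $\mathcal{H}_+$ be the set of everywhere strictly positive functions in $\mathcal{H}$, and put $\operatorname{Ent}_\mu(f)=\int f\log f\,d\mu-\int f\,d\mu\,\log\int f\,d\mu$. We say that $\mu$ satisfies the Poincaré inequality with constant $C$ if $\operatorname{Var}_\mu(f)\le\frac C2\,\mathcal{E}(f,f)$ for all $f\in\mathcal{H}$. We say that $\mu$ satisfies $p$-LS$(C)$, for $p\in(0,1)$, if \[ \operatorname{Ent}_\mu(f^p)\le\frac{Cp^2}{4(p-1)}\,\mathcal{E}(f^{p-1},f)\quad\text{for all } f\in\mathcal{H}_+ \text{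 with } f^{p-1}\in\mathcal{H}_+, \] and that it satisfies $1$-LS$(C)$ if $\operatorname{Ent}_\mu(f)\le\frac C4\,\mathcal{E}(f,\log f)$ for all $f\in\mathcal{H}_+$ with $\log f\in\mathcal{H}$. For $x>0$ set \[ H_p(x)=pp'\,(x^{1/p}-1)(x^{1/p'}-1)\ \text{ with } p'=\tfrac{p}{p-1}\ \text{ if } p\in(0,1),\qquad H_1(x)=(x-1)\log x . \] (Sufficiency) If $\mu$ satisfies the Poincaré inequality with some finite constant $C_P>0$ and \[ \sup_{n\ge 1}\ \Bigl[H_p\Bigl(\frac{\mu[n-1,\infty)}{\mu[n,\infty)}\Bigr)\Bigr]^{-1}\log\Bigl(\frac{2}{\mu[n,\infty)}\Bigr)<\infty , \] then $\mu$ satisfies $p$-LS$(C)$ for some finite $C>0$. (Necessity) If there is a strictly increasing sequence $\tau_0<\tau_1<\cdots$ in $\mathbb{N}$ such that \[ \lim_{n\to\infty}\ \Bigl[H_p\Bigl(\frac{\mu[\tau_{n-1},\infty)}{\mu[\tau_n,\infty)}\Bigr)\Bigr]^{-1}\cdot\frac{\mu[\tau_{n-1},\infty)}{\mu[\tau_n-1,\infty)}\cdot\log\Bigl(\frac{2}{\mu[\tau_n,\infty)}\Bigr)=\infty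 , \] then $\mu$ does not satisfy $p$-LS$(C)$ for any finite $C>0$. -/

import Mathlib

open MeasureTheory ProbabilityTheory Filter Topology

namespace BirthDeath

/-- Forward difference `Df(k) = f(k+1) - f(k)`. -/
def fwd (f : ℕ → ℝ) (k : ℕ) : ℝ := f (k + 1) - f k

/-- The tail `μ[n,∞)`, as a real number. -/
noncomputable def tail (μ : Measure ℕ) (n : ℕ) : ℝ := μ.real (Set.Ici n)

/-- The domain `ℋ` of the birth-death Dirichlet form:
square-integrable `f` with `∑ (Df(k))² μ_k < ∞`. -/
def Dom (μ : Measure ℕ) (f : ℕ → ℝ) : Prop :=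
  MemLp f 2 μ ∧ Summable fun k => (fwd f k) ^ 2 * μ.real {k}

/-- The class `ℋ₊` of everywhere strictly positive elements of `ℋ`. -/
def DomPos (μ : Measure ℕ) (f : ℕ → ℝ) : Prop :=
  Dom μ f ∧ ∀ k, 0 < f k

/-- The birth-death Dirichlet form `ℰ(f,g) = ∑ Df(k) Dg(k) μ_k`
(the series converges absolutely for `f, g` in `ℋ`). -/
noncomputable def form (μ : Measure ℕ) (f g : ℕ → ℝ) : ℝ :=
  ∑' k, fwd f k * fwd g k * μ.real {k}

/-- Entropy `Ent_μ(f) = ∫ f log f dμ - (∫ f dμ) log (∫ f dμ)`. -/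
noncomputable def Ent (μ : Measure ℕ) (f : ℕ → ℝ) : ℝ :=
  ∫ k, f k * Real.log (f k) ∂μ - (∫ k, f k ∂μ) * Real.log (∫ k, f k ∂μ)

/-- Poincaré inequality with constant `C`: `Var_μ(f) ≤ (C/2) ℰ(f,f)` for all `f` in `ℋ`. -/
def Poincare (μ : Measure ℕ) (C : ℝ) : Prop :=
  ∀ f : ℕ → ℝ, Dom μ f → Var[f; μ] ≤ C / 2 * form μ f f

/-- The `p`-log-Sobolev inequality with constant `C`, for `p ∈ (0,1]`. On the classes of functions
below, all the integrals and series involved converge absolutely. -/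
def LogSobolev (μ : Measure ℕ) (p C : ℝ) : Prop :=
  if p = 1 then
    ∀ f : ℕ → ℝ, DomPos μ f → Dom μ (fun k => Real.log (f k)) →
      Ent μ f ≤ C / 4 * form μ f (fun k => Real.log (f k))
  else
    ∀ f : ℕ → ℝ, DomPos μ f → DomPos μ (fun k => f k ^ (p - 1)) →
      Ent μ (fun k => f k ^ p) ≤ C * p ^ 2 / (4 * (p - 1)) * form μ (fun k => f k ^ (p - 1)) f

/-- The Hölder conjugate exponent `p' = p/(p-1)`, for `p ≠ 1`. -/
noncomputable def conj (p : ℝ) : ℝ := p / (p - 1)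

/-- `H_p(x) = p p' (x^{1/p} - 1)(x^{1/p'} - 1)` for `p ∈ (0,1)` and `H_1(x) = (x - 1) log x`,
where `x > 0`. -/
noncomputable def H (p x : ℝ) : ℝ :=
  if p = 1 then (x - 1) * Real.log x
  else p * conj p * (x ^ (1 / p) - 1) * (x ^ (1 / conj p) - 1)

end BirthDeath

/-! Writing `g = f ^ p` turns the energy, up to a constant, into the sum of g(k) H_p(g(k+1)/g(k))
μ_k, so one argument about H_p covers every p in (0,1]. Two features of H_p matter: it dominates (√x
- 1)², and for large x it dominates x log x, with H_p(x)/x increasing up to constants.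

Sufficiency. Normalize ∫ g = 1. The integrand g log g - g + 1 is at most a multiple of (√g - 1)²,
which Poincaré for √g controls, plus g log⁺(g/K). Put b(k) = g(k) log⁺(g(k)/K) μ_k and let r be the
ratio of the tails at k and k+1. The growth condition makes μ_k comparable to the tail at k and
bounds log⁺(g(k)/K) by a multiple of H_p(r). If g grows from k to k+1 by a factor well below r, the
loss of mass halves the old logarithm's contribution; otherwise the energy pays for it, by
superlinearity of H_p. Hence b(k+1) ≤ e(k) + b(k)/2 with e summable (`posLog_step_le`), and this
sums.

Necessity. Test on step functions equal to the inverse tail at σ(j) between consecutive times,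
stopped after n steps. Along a subsequence whose tails at least halve
(`exists_halving_subsequence`), the mass is O(n), ∫ g log g is at least S/2, where S is the sum of
the logarithms of the inverse tails, and the energy side is at most S/4 + O(n). Since S is at least
of order n², while mass times log mass is O(n log n), large n gives a contradiction. -/

namespace BirthDeath

/-! ### The profile H_p: symmetry, monotonicity and growth -/

lemma H_one (x : ℝ) : H 1 x = (x - 1) * Real.log x := by simp [H]

/-- The conjugate exponent is negative. With q = (1-p)/p > 0, both factors in this form are
nonnegative for x ≥ 1 and the growth rate 1 + q is visible. -/
lemma H_of_lt {p : ℝ} (hp0 : 0 < p) (hp1 : p < 1) (x : ℝ) :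
    H p x = p ^ 2 / (1 - p) * (x ^ (1 + (1 - p) / p) - 1) * (1 - x ^ (-((1 - p) / p))) := by
  have h1 : (1 : ℝ) / p = 1 + (1 - p) / p := by field_simp; ring
  have h2 : 1 / conj p = -((1 - p) / p) := by
    rw [conj, one_div_div, ← neg_div, neg_sub]
  have h3 : p * conj p = -(p ^ 2 / (1 - p)) := by
    have : p - 1 ≠ 0 := by linarith
    have : 1 - p ≠ 0 := by linarith
    rw [conj]; field_simp; ring
  rw [H, if_neg hp1.ne, h1, h2, h3]; ring

/-- The two-point energy of the `p`-log-Sobolev inequality in terms of `H`. -/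
lemma H_two_point {p : ℝ} (hp0 : 0 < p) (hp1 : p < 1) {x y : ℝ} (hx : 0 < x) (hy : 0 < y) :
    p ^ 2 / (p - 1) * ((y ^ (p - 1) - x ^ (p - 1)) * (y - x)) = x ^ p * H p (y ^ p / x ^ p) := by
  have h1 : p - 1 ≠ 0 := by linarith
  have h2 : 1 - p ≠ 0 := by linarith
  have e1 : (y ^ p / x ^ p) ^ (1 + (1 - p) / p) = y / x := by
    rw [← Real.div_rpow hy.le hx.le, ← Real.rpow_mul (div_pos hy hx).le]
    have : p * (1 + (1 - p) / p) = 1 := by field_simp; ring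
    rw [this, Real.rpow_one]
  have e2 : (y ^ p / x ^ p) ^ (-((1 - p) / p)) = y ^ (p - 1) / x ^ (p - 1) := by
    rw [← Real.div_rpow hy.le hx.le, ← Real.rpow_mul (div_pos hy hx).le,
      ← Real.div_rpow hy.le hx.le]
    congr 1; field_simp; ring
  have e3 : x ^ p = x * x ^ (p - 1) := by
    rw [Real.rpow_sub_one hx.ne']; field_simp
  have h3 : x ^ (p - 1) ≠ 0 := (Real.rpow_pos_of_pos hx _).ne'
  rw [H_of_lt hp0 hp1, e1, e2, e3]
  field_simp
  ring

/-- The two-point energy is symmetric in its points; this reduces estimates to x ≥ 1. -/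
lemma H_inv {p x : ℝ} (hp0 : 0 < p) (hp1 : p ≤ 1) (hx : 0 < x) : H p x = x * H p x⁻¹ := by
  rcases hp1.eq_or_lt with rfl | hp1
  · rw [H_one, H_one, Real.log_inv]; field_simp; ring
  · rw [H_of_lt hp0 hp1, H_of_lt hp0 hp1, Real.inv_rpow hx.le, Real.inv_rpow hx.le,
      Real.rpow_neg hx.le, inv_inv, Real.rpow_add hx, Real.rpow_one]
    have := (Real.rpow_pos_of_pos hx ((1 - p) / p)).ne'
    field_simp
    ring

lemma H_at_one (p : ℝ) : H p 1 = 0 := by simp [H]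

lemma H_monotoneOn {p : ℝ} (hp0 : 0 < p) (hp1 : p ≤ 1) : MonotoneOn (H p) (Set.Ici 1) := by
  intro x hx y hy hxy
  have hx' : (1 : ℝ) ≤ x := hx
  have hy' : (1 : ℝ) ≤ y := hy
  rcases hp1.eq_or_lt with rfl | hp1
  · rw [H_one, H_one]
    have := Real.log_le_log (by linarith) hxy
    have := Real.log_nonneg hx'
    exact mul_le_mul (by linarith) (by linarith) (by linarith) (by linarith)
  · have h2 : 0 < 1 - p := by linarith
    have hq : 0 < (1 - p) / p := by positivity
    rw [H_of_lt hp0 hp1, H_of_lt hp0 hp1]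
    have a1 := Real.rpow_le_rpow (by linarith) hxy (by positivity : 0 ≤ 1 + (1 - p) / p)
    have a2 := Real.one_le_rpow hx' (by positivity : 0 ≤ 1 + (1 - p) / p)
    have a3 := Real.rpow_le_rpow_of_nonpos (by linarith : 0 < x) hxy
      (by linarith : -((1 - p) / p) ≤ 0)
    have a4 := Real.rpow_le_one_of_one_le_of_nonpos hx' (by linarith : -((1 - p) / p) ≤ 0)
    have : 0 < p ^ 2 / (1 - p) := by positivity
    apply mul_le_mul (by gcongr) (by linarith) (by linarith)
    exact mul_nonneg this.le (by linarith)

lemma H_nonneg_of_one_le {p x : ℝ} (hp0 : 0 < p) (hp1 : p ≤ 1) (hx : 1 ≤ x) : 0 ≤ H p x := by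
  rw [← H_at_one p]
  exact H_monotoneOn hp0 hp1 (by simp) hx hx

lemma H_nonneg {p x : ℝ} (hp0 : 0 < p) (hp1 : p ≤ 1) (hx : 0 < x) : 0 ≤ H p x := by
  rcases le_total 1 x with h | h
  · exact H_nonneg_of_one_le hp0 hp1 h
  · rw [H_inv hp0 hp1 hx]
    exact mul_nonneg hx.le (H_nonneg_of_one_le hp0 hp1 ((one_le_inv₀ hx).2 h))

lemma min_one_mul_le_one_sub_rpow {y s : ℝ} (hs : 0 ≤ s) (hy0 : 0 < y) (hy1 : y ≤ 1) :
    min 1 s * (1 - y) ≤ 1 - y ^ s := by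
  rcases le_total s 1 with h | h
  · rw [min_eq_right h]
    have := rpow_one_add_le_one_add_mul_self (s := y - 1) (by linarith) hs h
    rw [add_sub_cancel] at this
    linarith
  · rw [min_eq_left h]
    have := Real.rpow_le_rpow_of_exponent_ge hy0 hy1 h
    rw [Real.rpow_one] at this
    linarith

/-- `H p` dominates the quadratic energy of the square root. -/
lemma exists_mul_sqrt_sub_one_sq_le_H {p : ℝ} (hp0 : 0 < p) (hp1 : p ≤ 1) :
    ∃ c : ℝ, 0 < c ∧ ∀ x : ℝ, 0 < x → c * (√x - 1) ^ 2 ≤ H p x := by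
  -- Both sides transform alike under inversion, since x (√(1/x) - 1)² = (√x - 1)², so only s = √x ≥
  -- 1 needs proof.
  suffices h : ∃ c : ℝ, 0 < c ∧ ∀ s : ℝ, 1 ≤ s → c * (s - 1) ^ 2 ≤ H p (s ^ 2) by
    obtain ⟨c, hc, h⟩ := h
    refine ⟨c, hc, fun x hx => ?_⟩
    have hs : 0 < √x := Real.sqrt_pos.2 hx
    rcases le_total 1 x with h1 | h1
    · have := h (√x) (by rwa [Real.one_le_sqrt])
      rwa [Real.sq_sqrt hx.le] at this
    · have h1' : 1 ≤ (√x)⁻¹ := (one_le_inv₀ hs).2 (Real.sqrt_le_iff.2 ⟨zero_le_one, by simpa using h1⟩)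
      have := h _ h1'
      rw [inv_pow, Real.sq_sqrt hx.le] at this
      rw [H_inv hp0 hp1 hx]
      refine le_trans (le_of_eq ?_) (mul_le_mul_of_nonneg_left this hx.le)
      have hx2 := Real.sq_sqrt hx.le
      nth_rewrite 2 [← hx2]
      field_simp
      ring
  rcases hp1.eq_or_lt with rfl | hp1
  · refine ⟨1, one_pos, fun s hs => ?_⟩
    have h1 := Real.one_sub_inv_le_log_of_pos (by positivity : 0 < s ^ 2)
    rw [H_one]
    calc 1 * (s - 1) ^ 2 ≤ (s ^ 2 - 1) * (1 - (s ^ 2)⁻¹) := by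
          have : (s ^ 2 - 1) * (1 - (s ^ 2)⁻¹) = (s - 1) ^ 2 * ((s + 1) ^ 2 / s ^ 2) := by
            field_simp; ring
          rw [this, one_mul]
          apply le_mul_of_one_le_right (by positivity)
          rw [one_le_div (by positivity)]
          gcongr; linarith
      _ ≤ _ := by
        apply mul_le_mul_of_nonneg_left h1
        nlinarith
  · have h2 : 0 < 1 - p := by linarith
    have hq : 0 < (1 - p) / p := by positivity
    set q := (1 - p) / p with hqdef
    refine ⟨p ^ 2 / (1 - p) * min 1 (2 * q), by positivity, fun s hs => ?_⟩
    have hs0 : 0 < s := by linarith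
    rw [H_of_lt hp0 hp1, ← hqdef]
    have e1 : s ^ 2 ≤ (s ^ 2) ^ (1 + q) := by
      have := Real.rpow_le_rpow_of_exponent_le (x := s ^ 2) (by nlinarith)
        (by linarith : 1 ≤ 1 + q)
      rwa [Real.rpow_one] at this
    have e2 := min_one_mul_le_one_sub_rpow (y := s⁻¹) (s := 2 * q) (by positivity)
      (by positivity) (inv_le_one_of_one_le₀ hs)
    have e3 : (s ^ 2) ^ (-q) = s⁻¹ ^ (2 * q) := by
      rw [Real.inv_rpow hs0.le, Real.rpow_neg (by positivity), Real.rpow_mul hs0.le, Real.rpow_two]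
    rw [e3, mul_assoc, mul_assoc]
    apply mul_le_mul_of_nonneg_left _ (by positivity)
    have e4 : (s - 1) ^ 2 ≤ (s ^ 2 - 1) * (1 - s⁻¹) := by
      have : (s ^ 2 - 1) * (1 - s⁻¹) = (s - 1) ^ 2 * ((s + 1) / s) := by
        field_simp; ring
      rw [this]
      apply le_mul_of_one_le_right (by positivity)
      rw [one_le_div (by positivity)]
      linarith
    have e5 : 0 ≤ 1 - s⁻¹ := by linarith [inv_le_one_of_one_le₀ hs]
    calc min 1 (2 * q) * (s - 1) ^ 2 ≤ min 1 (2 * q) * ((s ^ 2 - 1) * (1 - s⁻¹)) := by gcongr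
      _ = (s ^ 2 - 1) * (min 1 (2 * q) * (1 - s⁻¹)) := by ring
      _ ≤ _ := by
        apply mul_le_mul (by linarith) e2 (by positivity)
        nlinarith

lemma H_pos {p x : ℝ} (hp0 : 0 < p) (hp1 : p ≤ 1) (hx : 1 < x) : 0 < H p x := by
  obtain ⟨c, hc, h⟩ := exists_mul_sqrt_sub_one_sq_le_H hp0 hp1
  refine lt_of_lt_of_le ?_ (h x (by linarith))
  have : 0 < √x - 1 := by
    have := Real.lt_sqrt_of_sq_lt (x := 1) (y := x) (by simpa using hx)
    linarith
  positivity

/-- For `p < 1` and `x ≥ 2`, `H p x` is at least of order `x ^ (1 / p)`. -/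
lemma exists_mul_rpow_le_H {p : ℝ} (hp0 : 0 < p) (hp1 : p < 1) :
    ∃ c : ℝ, 0 < c ∧ ∀ x : ℝ, 2 ≤ x → c * x ^ (1 + (1 - p) / p) ≤ H p x := by
  have h2 : 0 < 1 - p := by linarith
  have hq : 0 < (1 - p) / p := by positivity
  set q := (1 - p) / p with hqdef
  have h3 : (2 : ℝ) ^ (-q) < 1 := Real.rpow_lt_one_of_one_lt_of_neg (by norm_num) (by linarith)
  have h4 : 0 < 1 - (2 : ℝ) ^ (-q) := by linarith
  refine ⟨p ^ 2 / (1 - p) * (1 / 2) * (1 - (2 : ℝ) ^ (-q)), by positivity, fun x hx => ?_⟩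
  rw [H_of_lt hp0 hp1, ← hqdef]
  have e1 : x ≤ x ^ (1 + q) := by
    have := Real.rpow_le_rpow_of_exponent_le (x := x) (by linarith)
      (by linarith : 1 ≤ 1 + q)
    rwa [Real.rpow_one] at this
  have e2 := Real.rpow_le_rpow_of_nonpos (by norm_num) hx (by linarith : -q ≤ 0)
  calc p ^ 2 / (1 - p) * (1 / 2) * (1 - (2 : ℝ) ^ (-q)) * x ^ (1 + q)
      = p ^ 2 / (1 - p) * (1 / 2 * x ^ (1 + q)) * (1 - (2 : ℝ) ^ (-q)) := by ring
    _ ≤ _ := by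
      apply mul_le_mul _ (by linarith) h4.le
      · apply mul_nonneg (by positivity); linarith
      · gcongr; linarith

lemma exists_mul_log_le_H {p : ℝ} (hp0 : 0 < p) (hp1 : p ≤ 1) :
    ∃ C : ℝ, 0 < C ∧ ∀ x : ℝ, 2 ≤ x → x * Real.log x ≤ C * H p x := by
  rcases hp1.eq_or_lt with rfl | hp1
  · refine ⟨2, two_pos, fun x hx => ?_⟩
    rw [H_one]
    nlinarith [Real.log_nonneg (by linarith : 1 ≤ x)]
  · obtain ⟨c, hc, h⟩ := exists_mul_rpow_le_H hp0 hp1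
    have h2 : 0 < 1 - p := by linarith
    have hq : 0 < (1 - p) / p := by positivity
    set q := (1 - p) / p with hqdef
    refine ⟨1 / q / c, by positivity, fun x hx => ?_⟩
    have hx0 : 0 < x := by linarith
    calc x * Real.log x ≤ x * (x ^ q / q) := by
          gcongr; exact Real.log_le_rpow_div hx0.le hq
      _ = 1 / q / c * (c * x ^ (1 + q)) := by
          rw [Real.rpow_add hx0, Real.rpow_one]; field_simp
      _ ≤ _ := by gcongr; exact h x hx

/-- Superlinearity of `H p` at comparable or larger arguments. -/
lemma exists_H_mul_div_le {p : ℝ} (hp0 : 0 < p) (hp1 : p ≤ 1) {ε : ℝ} (hε0 : 0 < ε)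
    (hε1 : ε ≤ 1) :
    ∃ C : ℝ, 0 < C ∧ ∀ x r : ℝ, 2 ≤ x → 1 ≤ r → ε * r ≤ x → H p r * (x / r) ≤ C * H p x := by
  rcases hp1.eq_or_lt with rfl | hp1
  · have hl : 0 ≤ Real.log ε⁻¹ := Real.log_nonneg ((one_le_inv₀ hε0).2 hε1)
    have hl2 : 0 < Real.log 2 := Real.log_pos (by norm_num)
    refine ⟨2 * (1 + Real.log ε⁻¹ / Real.log 2), by positivity, fun x r hx hr hxr => ?_⟩
    have hr0 : 0 < r := by linarith
    have hx0 : 0 < x := by linarith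
    have hlx : Real.log 2 ≤ Real.log x := Real.log_le_log (by norm_num) hx
    have h1 : Real.log r ≤ Real.log ε⁻¹ + Real.log x := by
      rw [← Real.log_mul (by positivity) hx0.ne']
      apply Real.log_le_log hr0
      rw [inv_mul_eq_div, le_div_iff₀ hε0]; linarith
    -- As log x ≥ log 2, the additive constant log(1/ε) is absorbed into a multiple of log x.
    have h2 : Real.log ε⁻¹ ≤ Real.log ε⁻¹ / Real.log 2 * Real.log x := by
      rw [div_mul_eq_mul_div, le_div_iff₀ hl2]; gcongr
    rw [H_one, H_one]
    have hlr : 0 ≤ Real.log r := Real.log_nonneg hr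
    calc (r - 1) * Real.log r * (x / r) ≤ r * Real.log r * (x / r) := by gcongr; linarith
      _ = x * Real.log r := by field_simp
      _ ≤ x * ((1 + Real.log ε⁻¹ / Real.log 2) * Real.log x) := by gcongr; linarith
      _ ≤ (2 * (x - 1)) * ((1 + Real.log ε⁻¹ / Real.log 2) * Real.log x) := by
        apply mul_le_mul_of_nonneg_right (by linarith)
        have : 0 ≤ Real.log x := by linarith
        positivity
      _ = _ := by ring
  · obtain ⟨c, hc, h⟩ := exists_mul_rpow_le_H hp0 hp1
    have h2 : 0 < 1 - p := by linarith
    have hq : 0 < (1 - p) / p := by positivity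
    set q := (1 - p) / p with hqdef
    set a := p ^ 2 / (1 - p) with ha
    have ha0 : 0 < a := by positivity
    refine ⟨a * (ε⁻¹ ^ q) / c, by positivity, fun x r hx hr hxr => ?_⟩
    have hr0 : 0 < r := by linarith
    have hx0 : 0 < x := by linarith
    have e1 : H p r ≤ a * r ^ (1 + q) := by
      rw [H_of_lt hp0 hp1, ← hqdef, ← ha]
      have a2 := Real.one_le_rpow hr (by positivity : 0 ≤ 1 + q)
      have a3 : 0 < r ^ (-q) := Real.rpow_pos_of_pos hr0 _
      calc a * (r ^ (1 + q) - 1) * (1 - r ^ (-q)) ≤ a * (r ^ (1 + q) - 1) * 1 := by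
            apply mul_le_mul_of_nonneg_left (by linarith)
            exact mul_nonneg ha0.le (by linarith)
        _ ≤ _ := by rw [mul_one]; gcongr; linarith
    have e2 : r ^ q ≤ ε⁻¹ ^ q * x ^ q := by
      rw [← Real.mul_rpow (by positivity) hx0.le]
      apply Real.rpow_le_rpow hr0.le _ hq.le
      rw [inv_mul_eq_div, le_div_iff₀ hε0]; linarith
    calc H p r * (x / r) ≤ a * r ^ (1 + q) * (x / r) := by gcongr
      _ = a * x * r ^ q := by rw [Real.rpow_add hr0, Real.rpow_one]; field_simp
      _ ≤ a * x * (ε⁻¹ ^ q * x ^ q) := by gcongr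
      _ = a * (ε⁻¹ ^ q) / c * (c * x ^ (1 + q)) := by
        rw [Real.rpow_add hx0, Real.rpow_one]; field_simp
      _ ≤ _ := by gcongr; exact h x hx

/-- `H p` is doubling up to an additive constant. -/
lemma exists_H_le_of_le_two_mul {p : ℝ} (hp0 : 0 < p) (hp1 : p ≤ 1) :
    ∃ C : ℝ, 0 < C ∧ ∀ x y : ℝ, 1 ≤ x → 1 ≤ y → y ≤ 2 * x → H p y ≤ C * (H p x + 1) := by
  obtain ⟨C, hC, h⟩ := exists_H_mul_div_le hp0 hp1 (ε := 1 / 2) (by norm_num) (by norm_num)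
  -- For x ≥ 2, superlinearity compares 2x with x; for x ≤ 2, y is at most 4 and H_p(4) suffices.
  refine ⟨2 * C + H p 4 + 1, ?_, fun x y hx hy hxy => ?_⟩
  · have := H_nonneg_of_one_le hp0 hp1 (by norm_num : (1 : ℝ) ≤ 4); positivity
  have h4 := H_nonneg_of_one_le hp0 hp1 (by norm_num : (1 : ℝ) ≤ 4)
  have hx' := H_nonneg_of_one_le hp0 hp1 hx
  rcases le_total 2 x with h2 | h2
  · have a1 := h x (2 * x) h2 (by linarith) (by linarith)
    have a2 := H_monotoneOn hp0 hp1 hy (by simp; linarith) hxy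
    have a3 : x / (2 * x) = 1 / 2 := by field_simp
    rw [a3] at a1
    nlinarith [mul_nonneg hC.le hx', mul_nonneg h4 hx']
  · have a2 := H_monotoneOn hp0 hp1 hy (by simp) (by linarith : y ≤ 4)
    nlinarith [mul_nonneg hC.le hx', mul_nonneg h4 hx']

lemma H_continuousAt_one {p : ℝ} (hp0 : 0 < p) (hp1 : p ≤ 1) : ContinuousAt (H p) 1 := by
  rcases hp1.eq_or_lt with rfl | hp1
  · have : H 1 = fun x => (x - 1) * Real.log x := funext H_one
    rw [this]
    exact (continuousAt_id.sub continuousAt_const).mul (Real.continuousAt_log one_ne_zero)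
  · rw [show H p = _ from funext (H_of_lt hp0 hp1)]
    have h (s : ℝ) : ContinuousAt (fun x : ℝ => x ^ s) 1 :=
      Real.continuousAt_rpow_const _ _ (Or.inl one_ne_zero)
    exact (continuousAt_const.mul ((h _).sub continuousAt_const)).mul
      (continuousAt_const.sub (h _))

/-- H_p is continuous at 1 and vanishes there, so a lower bound on H_p keeps the argument away from
1. -/
lemma exists_one_add_le_of_le_H {p : ℝ} (hp0 : 0 < p) (hp1 : p ≤ 1) {η : ℝ} (hη : 0 < η) :
    ∃ δ : ℝ, 0 < δ ∧ ∀ r : ℝ, 1 ≤ r → η ≤ H p r → 1 + δ ≤ r := by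
  have h := Metric.continuousAt_iff.1 (H_continuousAt_one hp0 hp1) η hη
  obtain ⟨δ, hδ, h⟩ := h
  refine ⟨δ, hδ, fun r hr hH => ?_⟩
  by_contra! hlt
  have := h (x := r) (by rw [Real.dist_eq, abs_lt]; constructor <;> linarith)
  rw [H_at_one, Real.dist_eq, sub_zero] at this
  linarith [le_abs_self (H p r)]

/-! ### Tails of μ, and integrals as series -/

section Tail

variable (μ : Measure ℕ) [IsProbabilityMeasure μ]

lemma tail_sub_tail_succ (n : ℕ) : tail μ n - tail μ (n + 1) = μ.real {n} := by
  have h : Set.Ici n = {n} ∪ Set.Ici (n + 1) := by ext k; simp; omega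
  rw [tail, tail, h, measureReal_union (by simp) measurableSet_Ici]
  ring

lemma tail_antitone : Antitone (tail μ) := fun _ _ h =>
  measureReal_mono (Set.Ici_subset_Ici.2 h)

lemma tail_le_one (n : ℕ) : tail μ n ≤ 1 := measureReal_le_one

lemma tendsto_tail : Tendsto (tail μ) atTop (𝓝 0) := by
  have h := tendsto_measure_iInter_atTop (μ := μ) (s := fun n : ℕ => Set.Ici n)
    (fun n => measurableSet_Ici.nullMeasurableSet) (fun _ _ h => Set.Ici_subset_Ici.2 h)
    ⟨0, measure_ne_top _ _⟩
  have h0 : ⋂ n : ℕ, Set.Ici n = ∅ := by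
    ext k; simp only [Set.mem_iInter, Set.mem_Ici, Set.mem_empty_iff_false, iff_false, not_forall]
    exact ⟨k + 1, by omega⟩
  rw [h0, measure_empty] at h
  exact (ENNReal.tendsto_toReal ENNReal.zero_ne_top).comp h

variable {μ} in
lemma real_singleton_pos (hμ : ∀ k : ℕ, 0 < μ {k}) (k : ℕ) : 0 < μ.real {k} :=
  ENNReal.toReal_pos (hμ k).ne' (measure_ne_top _ _)

variable {μ} in
lemma tail_strictAnti (hμ : ∀ k : ℕ, 0 < μ {k}) : StrictAnti (tail μ) :=
  strictAnti_nat_of_succ_lt fun n => by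
    linarith [tail_sub_tail_succ μ n, real_singleton_pos hμ n]

variable {μ} in
lemma tail_pos (hμ : ∀ k : ℕ, 0 < μ {k}) (n : ℕ) : 0 < tail μ n :=
  lt_of_le_of_lt measureReal_nonneg (tail_strictAnti hμ (Nat.lt_succ_self n))

lemma integrable_iff_summable_real {f : ℕ → ℝ} :
    Integrable f μ ↔ Summable fun k => f k * μ.real {k} := by
  have key : Integrable f μ ↔ Summable fun k => |f k| * μ.real {k} := by
    rw [Integrable, and_iff_right (measurable_of_countable f).aestronglyMeasurable,
      HasFiniteIntegral, lintegral_countable']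
    have (k : ℕ) : ‖f k‖ₑ * μ {k} = ENNReal.ofReal (|f k| * μ.real {k}) := by
      rw [ENNReal.ofReal_mul (abs_nonneg _), ofReal_measureReal, ← Real.enorm_eq_ofReal_abs]
    simp_rw [this]
    constructor
    · intro h
      have := ENNReal.summable_toReal h.ne
      refine this.congr fun k => ?_
      rw [ENNReal.toReal_ofReal (by positivity)]
    · intro h
      rw [← ENNReal.ofReal_tsum_of_nonneg (fun k => by positivity) h]
      exact ENNReal.ofReal_lt_top
  rw [key, ← summable_abs_iff (f := fun k => f k * μ.real {k})]
  simp_rw [abs_mul, abs_of_nonneg (measureReal_nonneg (μ := μ))]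

end Tail

lemma integral_eq_tsum_real (μ : Measure ℕ) {f : ℕ → ℝ} (hf : Integrable f μ) :
    ∫ k, f k ∂μ = ∑' k, f k * μ.real {k} := by
  rw [integral_countable hf]; simp [mul_comm]

/-! ### Sufficiency: the entropy bound -/

/-- The energy of `g`, in the parametrization of the `p`-log-Sobolev inequality by `g = f ^ p`. -/
noncomputable def energyTerm (μ : Measure ℕ) (p : ℝ) (g : ℕ → ℝ) (k : ℕ) : ℝ :=
  g k * H p (g (k + 1) / g k) * μ.real {k}

lemma energyTerm_nonneg (μ : Measure ℕ) {p : ℝ} (hp0 : 0 < p) (hp1 : p ≤ 1) {g : ℕ → ℝ}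
    (hg : ∀ k, 0 < g k) (k : ℕ) : 0 ≤ energyTerm μ p g k :=
  mul_nonneg (mul_nonneg (hg k).le (H_nonneg hp0 hp1 (div_pos (hg _) (hg k)))) measureReal_nonneg

/-- Summing the recursion bounds a partial sum of b by that of e plus half of a partial sum of b.
Working with finite sums by induction yields summability as well as the bound. -/
lemma summable_and_tsum_le_of_succ_le {b e : ℕ → ℝ} (hb0 : b 0 = 0) (hb : ∀ k, 0 ≤ b k)
    (he : ∀ k, 0 ≤ e k) (hs : Summable e) (h : ∀ k, b (k + 1) ≤ e k + b k / 2) :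
    Summable b ∧ ∑' k, b k ≤ 2 * ∑' k, e k := by
  have key : ∀ n, ∑ k ∈ Finset.range n, b k ≤ 2 * ∑' k, e k := by
    intro n
    induction n with
    | zero => simpa using tsum_nonneg he
    | succ n ih =>
      rw [Finset.sum_range_succ', hb0, add_zero]
      have h1 : ∑ k ∈ Finset.range n, b (k + 1) ≤ ∑ k ∈ Finset.range n, (e k + b k / 2) :=
        Finset.sum_le_sum fun k _ => h k
      rw [Finset.sum_add_distrib, ← Finset.sum_div] at h1
      have h2 := hs.sum_le_tsum (Finset.range n) (fun k _ => he k)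
      linarith
  exact ⟨summable_of_sum_range_le hb key, Real.tsum_le_of_sum_range_le hb key⟩

/-- For h ≤ K, log h ≤ 2(√h - 1) leaves exactly (2√h + 1)(√h - 1)². For h ≥ K ≥ 4, h ≤ 4(√h - 1)²
absorbs h log K, and only h log(h/K) remains. -/
lemma mul_log_sub_le_of_le {h K : ℝ} (hh : 0 < h) (hK : 4 ≤ K) :
    h * Real.log h - h + 1 ≤
      (2 * √K + 1 + 4 * Real.log K) * (√h - 1) ^ 2 + h * Real.posLog (h / K) := by
  have hK0 : 0 < K := by linarith
  have hlK : 0 ≤ Real.log K := Real.log_nonneg (by linarith)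
  have hs : 0 < √h := Real.sqrt_pos.2 hh
  have hsq := Real.sq_sqrt hh.le
  have hpl : 0 ≤ Real.posLog (h / K) := Real.posLog_nonneg
  rcases le_total h K with h1 | h1
  · have e1 : Real.log h = 2 * Real.log (√h) := by
      rw [Real.log_sqrt hh.le]; ring
    have e2 := Real.log_le_sub_one_of_pos hs
    have e3 : √h ≤ √K := Real.sqrt_le_sqrt h1
    calc h * Real.log h - h + 1 = h * 2 * Real.log (√h) - h + 1 := by rw [e1]; ring
      _ ≤ h * 2 * (√h - 1) - h + 1 := by gcongr
      _ = (2 * √h + 1) * (√h - 1) ^ 2 := by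
        generalize √h = s at *; rw [← hsq]; ring
      _ ≤ (2 * √K + 1 + 4 * Real.log K) * (√h - 1) ^ 2 := by
        apply mul_le_mul_of_nonneg_right _ (sq_nonneg _)
        linarith
      _ ≤ _ := by linarith [mul_nonneg hh.le hpl]
  · have e1 : Real.log h = Real.log (h / K) + Real.log K := by
      rw [Real.log_div hh.ne' hK0.ne']; ring
    have e2 : Real.log (h / K) ≤ Real.posLog (h / K) := le_max_right _ _
    have e3 : 2 ≤ √h := Real.le_sqrt_of_sq_le (by linarith)
    have e4 : h ≤ 4 * (√h - 1) ^ 2 := by nlinarith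
    have e5 : 0 ≤ (2 * √K + 1) * (√h - 1) ^ 2 := by positivity
    have e6 : h * Real.log K ≤ 4 * (√h - 1) ^ 2 * Real.log K := by gcongr
    have e7 : h * Real.log (h / K) ≤ h * Real.posLog (h / K) := by gcongr
    rw [e1]
    nlinarith

/-- The one-step estimate behind the entropy bound. -/
lemma posLog_step_le {p : ℝ} (hp0 : 0 < p) (hp1 : p ≤ 1) {C₂ C₃ c₀ B K : ℝ}
    (hC₂ : 0 < C₂) (hC₃ : 0 < C₃) (hc₀ : 1 ≤ c₀) (hB : 0 < B) (hK4 : 4 ≤ K)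
    (hlog : ∀ x : ℝ, 2 ≤ x → x * Real.log x ≤ C₂ * H p x)
    (hsup : ∀ x r : ℝ, 2 ≤ x → 1 ≤ r → 1 / (2 * c₀) * r ≤ x → H p r * (x / r) ≤ C₃ * H p x)
    {m m' a a' r : ℝ} (hm : 0 < m) (hm' : 0 < m') (ha : 0 < a) (ha' : 0 < a') (hr : 1 ≤ r)
    (hmm : m' * r ≤ c₀ * m) (hbig : K < a → 4 * c₀ ≤ r)
    (hH : Real.posLog (a / K) ≤ B * H p r) :
    a' * Real.posLog (a' / K) * m' ≤
      4 * ((√a' - 1) ^ 2 * m') + (c₀ * C₂ + c₀ * B * C₃) * (a * H p (a' / a) * m) +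
        a * Real.posLog (a / K) * m / 2 := by
  have hK0 : 0 < K := by linarith
  have hx : 0 < a' / a := by positivity
  set x := a' / a with hxdef
  have hax : a' = x * a := by rw [hxdef]; field_simp
  have hE : 0 ≤ a * H p x * m := by
    have := H_nonneg hp0 hp1 hx; positivity
  have hl0 : 0 ≤ Real.posLog (a / K) := Real.posLog_nonneg
  have hr0 : 0 < r := by linarith
  have hmc : m' ≤ c₀ * m := le_trans (le_mul_of_one_le_right hm'.le hr) hmm
  rcases le_or_gt a' K with h1 | h1
  · have : Real.posLog (a' / K) = 0 := by
      rw [Real.posLog_eq_zero_iff, abs_of_pos (by positivity), div_le_one hK0]; exact h1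
    rw [this]
    simp only [mul_zero, zero_mul]
    positivity
  -- The new logarithm splits into the part created by the jump x, bounded in `t1`, and the
  -- inherited part, bounded in `t2`.
  have hsplit : Real.posLog (a' / K) ≤ Real.posLog x + Real.posLog (a / K) := by
    rw [hax, mul_div_assoc]; exact Real.posLog_mul
  have t1 : a' * Real.posLog x * m' ≤ 4 * ((√a' - 1) ^ 2 * m') + c₀ * C₂ * (a * H p x * m) := by
    rcases le_total x 2 with h2 | h2
    · have : Real.posLog x ≤ 1 := by
        rw [Real.posLog, max_le_iff]
        refine ⟨zero_le_one, ?_⟩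
        linarith [Real.log_le_sub_one_of_pos hx]
      have e3 : 2 ≤ √a' := Real.le_sqrt_of_sq_le (by linarith)
      have e4 : a' ≤ 4 * (√a' - 1) ^ 2 := by nlinarith [Real.sq_sqrt ha'.le]
      calc a' * Real.posLog x * m' ≤ 4 * (√a' - 1) ^ 2 * 1 * m' := by
            have : 0 ≤ Real.posLog x := Real.posLog_nonneg
            gcongr
        _ ≤ _ := by
          have : 0 ≤ c₀ * C₂ * (a * H p x * m) := by positivity
          linarith
    · rw [Real.posLog_eq_log (by rw [abs_of_pos hx]; linarith)]
      calc a' * Real.log x * m' = a * m' * (x * Real.log x) := by rw [hax]; ring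
        _ ≤ a * (c₀ * m) * (C₂ * H p x) := by
          have : 0 ≤ Real.log x := Real.log_nonneg (by linarith)
          gcongr ?_ * ?_
          · gcongr
          · exact hlog x h2
        _ = c₀ * C₂ * (a * H p x * m) := by ring
        _ ≤ _ := by
          have : 0 ≤ 4 * ((√a' - 1) ^ 2 * m') := by positivity
          linarith
  have t2 : a' * Real.posLog (a / K) * m' ≤
      c₀ * B * C₃ * (a * H p x * m) + a * Real.posLog (a / K) * m / 2 := by
    rcases le_or_gt a K with h2 | h2
    · have : Real.posLog (a / K) = 0 := by
        rw [Real.posLog_eq_zero_iff, abs_of_pos (by positivity), div_le_one hK0]; exact h2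
      rw [this]
      simp only [mul_zero, zero_mul]
      positivity
    have hr4 := hbig h2
    have e1 : a' * Real.posLog (a / K) * m' ≤ c₀ * m * a * (x / r) * Real.posLog (a / K) := by
      calc a' * Real.posLog (a / K) * m' = m' * r * a * (x / r) * Real.posLog (a / K) := by
            rw [hax]; field_simp
        _ ≤ _ := by gcongr
    refine e1.trans ?_
    -- The threshold r/(2c₀) is where the factor c₀ x/r equals 1/2: below it there is contraction,
    -- above it the energy pays.
    rcases le_total x (1 / (2 * c₀) * r) with h3 | h3
    · have : x / r ≤ 1 / (2 * c₀) := by rwa [div_le_iff₀ hr0]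
      calc c₀ * m * a * (x / r) * Real.posLog (a / K)
          ≤ c₀ * m * a * (1 / (2 * c₀)) * Real.posLog (a / K) := by gcongr
        _ = a * Real.posLog (a / K) * m / 2 := by field_simp
        _ ≤ _ := by
          have : 0 ≤ c₀ * B * C₃ * (a * H p x * m) := by positivity
          linarith
    -- Here `hbig` is used: r ≥ 4c₀ puts x in the range x ≥ 2 where superlinearity holds.
    · have hx2 : 2 ≤ x := by
        refine le_trans ?_ h3
        rw [div_mul_eq_mul_div, le_div_iff₀ (by positivity)]; linarith
      calc c₀ * m * a * (x / r) * Real.posLog (a / K)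
          ≤ c₀ * m * a * (x / r) * (B * H p r) := by gcongr
        _ = c₀ * m * a * B * (H p r * (x / r)) := by ring
        _ ≤ c₀ * m * a * B * (C₃ * H p x) := by
          gcongr ?_ * ?_; exact hsup x r hx2 hr h3
        _ = c₀ * B * C₃ * (a * H p x * m) := by ring
        _ ≤ _ := by
          have : 0 ≤ a * Real.posLog (a / K) * m / 2 := by positivity
          linarith
  calc a' * Real.posLog (a' / K) * m' ≤ a' * (Real.posLog x + Real.posLog (a / K)) * m' := by
        gcongr
    _ = a' * Real.posLog x * m' + a' * Real.posLog (a / K) * m' := by ring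
    _ ≤ _ := by linarith

/-- The Poincaré inequality for `√g` controls the distance of `√g` to `1`. -/
lemma integral_sqrt_sub_one_sq_le {μ : Measure ℕ} [IsProbabilityMeasure μ] {p c C : ℝ}
    (hc : 0 < c) (hC : 0 < C)
    (hH : ∀ x : ℝ, 0 < x → c * (√x - 1) ^ 2 ≤ H p x) (hP : Poincare μ C) {g : ℕ → ℝ}
    (hg : ∀ k, 0 < g k) (hint : Integrable g μ) (h1 : ∫ k, g k ∂μ = 1)
    (hE : Summable (energyTerm μ p g)) :
    Integrable (fun k => (√(g k) - 1) ^ 2) μ ∧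
      ∫ k, (√(g k) - 1) ^ 2 ∂μ ≤ C / c * ∑' k, energyTerm μ p g k := by
  have hm : AEStronglyMeasurable (fun k => √(g k)) μ :=
    (measurable_of_countable _).aestronglyMeasurable
  have hsq : (fun k => √(g k) ^ 2) = g := funext fun k => Real.sq_sqrt (hg k).le
  have hL2 : MemLp (fun k => √(g k)) 2 μ := by
    rw [memLp_two_iff_integrable_sq hm, hsq]; exact hint
  have hstep (k : ℕ) : (fwd (fun k => √(g k)) k) ^ 2 * μ.real {k} ≤
      c⁻¹ * energyTerm μ p g k := by
    have e : (fwd (fun k => √(g k)) k) ^ 2 = g k * (√(g (k + 1) / g k) - 1) ^ 2 := by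
      have hs := Real.sq_sqrt (hg k).le
      have hs0 := Real.sqrt_pos.2 (hg k)
      rw [fwd, Real.sqrt_div (hg _).le]
      field_simp
      rw [hs]
      ring
    rw [e, energyTerm, ← mul_assoc]
    apply mul_le_mul_of_nonneg_right _ measureReal_nonneg
    have := hH _ (div_pos (hg (k + 1)) (hg k))
    rw [mul_left_comm]
    apply mul_le_mul_of_nonneg_left _ (hg k).le
    rwa [le_inv_mul_iff₀ hc]
  have hsum : Summable fun k => (fwd (fun k => √(g k)) k) ^ 2 * μ.real {k} :=
    Summable.of_nonneg_of_le (fun k => by positivity) hstep (hE.mul_left _)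
  have hvar := hP _ ⟨hL2, hsum⟩
  have hform : form μ (fun k => √(g k)) (fun k => √(g k)) ≤ c⁻¹ * ∑' k, energyTerm μ p g k := by
    rw [form, ← tsum_mul_left]
    simp_rw [← sq]
    exact hsum.tsum_le_tsum hstep (hE.mul_left _)
  have hvar0 := variance_nonneg (fun k => √(g k)) μ
  rw [variance_eq_sub hL2] at hvar hvar0
  have e1 : ∫ k, ((fun k => √(g k)) ^ 2) k ∂μ = 1 := by
    rw [← h1]; exact congrArg _ hsq
  rw [e1] at hvar hvar0
  have hs0 : 0 ≤ ∫ k, √(g k) ∂μ := integral_nonneg fun k => Real.sqrt_nonneg _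
  have hsI : Integrable (fun k => √(g k)) μ := hL2.integrable one_le_two
  have e2 : (fun k => (√(g k) - 1) ^ 2) = fun k => g k - 2 * √(g k) + 1 := by
    funext k; linear_combination Real.sq_sqrt (hg k).le
  have hI2 : Integrable (fun k => g k - 2 * √(g k)) μ := hint.sub (hsI.const_mul 2)
  refine ⟨by rw [e2]; exact hI2.add (integrable_const _), ?_⟩
  rw [e2, integral_add hI2 (integrable_const _), integral_sub hint (hsI.const_mul 2),
    integral_const_mul, h1]
  simp only [integral_const, probReal_univ, smul_eq_mul, mul_one]
  have : C / 2 * form μ (fun k => √(g k)) (fun k => √(g k)) ≤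
      C / 2 * (c⁻¹ * ∑' k, energyTerm μ p g k) := by gcongr
  have e3 : C / c * ∑' k, energyTerm μ p g k = 2 * (C / 2 * (c⁻¹ * ∑' k, energyTerm μ p g k)) := by
    field_simp
  rw [e3]
  -- With s = ∫ √g in [0,1], the left side is 2(1 - s) ≤ 2(1 - s²), twice the variance of √g.
  nlinarith

/-- Consequences of the growth condition on the tails. -/
lemma exists_tail_bounds {p : ℝ} (hp0 : 0 < p) (hp1 : p ≤ 1) {μ : Measure ℕ}
    [IsProbabilityMeasure μ] (hμ : ∀ k : ℕ, 0 < μ {k})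
    (hbdd : BddAbove ((fun n : ℕ => (H p (tail μ (n - 1) / tail μ n))⁻¹ *
      Real.log (2 / tail μ n)) '' Set.Ici 1)) :
    ∃ c₀ B : ℝ, 1 ≤ c₀ ∧ 0 < B ∧ ∀ k, tail μ k ≤ c₀ * μ.real {k} ∧
      Real.log (2 / tail μ (k + 1)) ≤ B * H p (tail μ k / tail μ (k + 1)) := by
  obtain ⟨B, hB⟩ := hbdd
  have hr (k : ℕ) : 1 < tail μ k / tail μ (k + 1) := by
    rw [one_lt_div (tail_pos hμ _)]; exact tail_strictAnti hμ k.lt_succ_self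
  have hlog (k : ℕ) : Real.log (2 / tail μ (k + 1)) ≤
      max B 1 * H p (tail μ k / tail μ (k + 1)) := by
    have h := hB ⟨k + 1, by simp, rfl⟩
    simp only [Nat.add_sub_cancel] at h
    have hpos := H_pos hp0 hp1 (hr k)
    rw [inv_mul_le_iff₀ hpos] at h
    refine h.trans ?_
    rw [mul_comm]
    gcongr; exact le_max_left _ _
  have hB0 : 0 < max B 1 := by positivity
  have hl2 : 0 < Real.log 2 := Real.log_pos (by norm_num)
  -- Since 2/tail ≥ 2, the growth condition forces H_p of each tail ratio above log 2 / max B 1.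
  -- Each ratio is then at least 1 + δ, so a fixed fraction of every tail sits at its first point.
  obtain ⟨δ, hδ, h⟩ := exists_one_add_le_of_le_H hp0 hp1 (η := Real.log 2 / max B 1)
    (by positivity)
  refine ⟨(1 + δ) / δ, max B 1, ?_, hB0, fun k => ⟨?_, hlog k⟩⟩
  · rw [one_le_div hδ]; linarith
  · have hT := tail_pos hμ (k + 1)
    have h2 := h _ (hr k).le (by
      rw [div_le_iff₀ hB0, mul_comm]
      refine le_trans ?_ (hlog k)
      apply Real.log_le_log (by norm_num)
      rw [le_div_iff₀ hT]
      linarith [tail_le_one μ (k + 1)])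
    rw [le_div_iff₀ hT] at h2
    rw [← tail_sub_tail_succ, div_mul_eq_mul_div, le_div_iff₀ hδ]
    linarith

/-- The entropy bound for normalized positive functions. -/
lemma exists_integral_mul_log_le {p : ℝ} (hp0 : 0 < p) (hp1 : p ≤ 1) {μ : Measure ℕ}
    [IsProbabilityMeasure μ] (hμ : ∀ k : ℕ, 0 < μ {k}) {CP : ℝ} (hCP : 0 < CP)
    (hP : Poincare μ CP)
    (hbdd : BddAbove ((fun n : ℕ => (H p (tail μ (n - 1) / tail μ n))⁻¹ *
      Real.log (2 / tail μ n)) '' Set.Ici 1)) :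
    ∃ C : ℝ, 0 < C ∧ ∀ g : ℕ → ℝ, (∀ k, 0 < g k) → Integrable g μ → ∫ k, g k ∂μ = 1 →
      Summable (energyTerm μ p g) → Integrable (fun k => g k * Real.log (g k)) μ ∧
        ∫ k, g k * Real.log (g k) ∂μ ≤ C * ∑' k, energyTerm μ p g k := by
  obtain ⟨c, hc, hsqrt⟩ := exists_mul_sqrt_sub_one_sq_le_H hp0 hp1
  obtain ⟨c₀, B, hc₀, hB, hT⟩ := exists_tail_bounds hp0 hp1 hμ hbdd
  obtain ⟨C₂, hC₂, hlog⟩ := exists_mul_log_le_H hp0 hp1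
  obtain ⟨C₃, hC₃, hsup⟩ := exists_H_mul_div_le hp0 hp1 (ε := 1 / (2 * c₀)) (by positivity)
    (by rw [div_le_one (by positivity)]; linarith)
  set A := B * H p (4 * c₀) with hA
  have hA0 : 0 ≤ A := mul_nonneg hB.le (H_nonneg_of_one_le hp0 hp1 (by linarith))
  -- K serves twice: g(0) ≤ 1/μ_0 ≤ K makes b(0) vanish, and g(k) > K makes the tail at k so small
  -- that its logarithm exceeds A, which forces r ≥ 4c₀.
  set K := 4 * c₀ * Real.exp A / μ.real {0} with hKdef
  have hm0 := real_singleton_pos hμ 0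
  have hm01 : μ.real {0} ≤ 1 := measureReal_le_one
  have hK : 4 * c₀ * Real.exp A ≤ K := by
    rw [hKdef, le_div_iff₀ hm0]
    exact mul_le_of_le_one_right (by positivity) hm01
  have hexp := Real.one_le_exp hA0
  have hK4 : 4 * c₀ ≤ K := le_trans (le_mul_of_one_le_right (by positivity) hexp) hK
  have hK0 : 0 < K := by linarith
  set D := c₀ * C₂ + c₀ * B * C₃ with hD
  set M := 2 * √K + 1 + 4 * Real.log K with hM
  have hM0 : 0 ≤ M := by
    have := Real.log_nonneg (by linarith : 1 ≤ K); positivity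
  refine ⟨M * (CP / c) + 2 * (4 * (CP / c) + D), by positivity, fun g hg hint h1 hE => ?_⟩
  obtain ⟨hW, hWle⟩ := integral_sqrt_sub_one_sq_le hc hCP hsqrt hP hg hint h1 hE
  rw [integral_eq_tsum_real μ hW] at hWle
  rw [integrable_iff_summable_real] at hW
  have hgs := (integrable_iff_summable_real μ).1 hint
  rw [integral_eq_tsum_real μ hint] at h1
  have hmpos := real_singleton_pos hμ
  have hg1 (k : ℕ) : g k * μ.real {k} ≤ 1 := by
    rw [← h1]
    exact hgs.le_tsum k fun j _ => mul_nonneg (hg j).le (hmpos j).le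
  have hE0 := energyTerm_nonneg μ hp0 hp1 hg
  have hTpos := tail_pos hμ
  have hr (k : ℕ) : 1 ≤ tail μ k / tail μ (k + 1) := by
    rw [one_le_div (hTpos _)]; exact tail_antitone μ k.le_succ
  have hL (k : ℕ) : Real.log (2 / tail μ k) ≤ Real.log (2 / tail μ (k + 1)) := by
    have := hTpos k
    have := hTpos (k + 1)
    apply Real.log_le_log (by positivity)
    gcongr; exact tail_antitone μ k.le_succ
  obtain ⟨hbs, hble⟩ := summable_and_tsum_le_of_succ_le
    (b := fun k => g k * Real.posLog (g k / K) * μ.real {k})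
    (e := fun k => 4 * ((√(g (k + 1)) - 1) ^ 2 * μ.real {k + 1}) + D * energyTerm μ p g k)
    (by
      have : Real.posLog (g 0 / K) = 0 := by
        rw [Real.posLog_eq_zero_iff, abs_of_pos (div_pos (hg 0) hK0), div_le_one hK0, hKdef,
          le_div_iff₀ hm0]
        refine (hg1 0).trans ?_
        nlinarith
      simp only [this, mul_zero, zero_mul])
    (fun k => mul_nonneg (mul_nonneg (hg k).le Real.posLog_nonneg) (hmpos k).le)
    (fun k => by have := hE0 k; positivity)
    ((((summable_nat_add_iff 1).2 hW).mul_left 4).add (hE.mul_left D))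
    (fun k => by
      have hgk : g k ≤ c₀ / tail μ k := by
        rw [le_div_iff₀ (hTpos k)]
        calc g k * tail μ k ≤ g k * (c₀ * μ.real {k}) :=
              mul_le_mul_of_nonneg_left (hT k).1 (hg k).le
          _ = c₀ * (g k * μ.real {k}) := by ring
          _ ≤ c₀ := mul_le_of_le_one_right (by linarith) (hg1 k)
      refine posLog_step_le hp0 hp1 hC₂ hC₃ hc₀ hB (by linarith) hlog hsup (hmpos k)
        (hmpos (k + 1)) (hg k) (hg (k + 1)) (r := tail μ k / tail μ (k + 1)) (hr k) ?_ ?_ ?_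
      · refine le_trans ?_ (hT k).1
        rw [mul_div_assoc', div_le_iff₀ (hTpos _), mul_comm]
        gcongr
        · exact (hTpos k).le
        · have := hTpos (k + 1 + 1)
          linarith [tail_sub_tail_succ μ (k + 1)]
      · intro hKg
        by_contra! hlt
        have h2 := H_monotoneOn hp0 hp1 (hr k) (by simp; linarith) hlt.le
        have h3 : A < Real.log (2 / tail μ k) := by
          rw [Real.lt_log_iff_exp_lt (div_pos two_pos (hTpos k)), lt_div_iff₀ (hTpos k)]
          have h4 := hKg.trans_le hgk
          rw [lt_div_iff₀ (hTpos k)] at h4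
          have h5 : 4 * c₀ * Real.exp A * tail μ k ≤ K * tail μ k := by
            have := hTpos k
            gcongr
          have h6 : c₀ * (4 * (Real.exp A * tail μ k)) < c₀ * 1 := by linarith
          have h7 := lt_of_mul_lt_mul_left h6 (by linarith)
          linarith
        have h4 : B * H p (tail μ k / tail μ (k + 1)) ≤ A := by
          rw [hA]; gcongr
        linarith [hL k, (hT k).2]
      · refine le_trans ?_ ((hL k).trans (hT k).2)
        rw [Real.posLog, max_le_iff]
        constructor
        · apply Real.log_nonneg
          rw [le_div_iff₀ (hTpos k)]
          linarith [tail_le_one μ k]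
        · apply Real.log_le_log (div_pos (hg k) hK0)
          rw [div_le_iff₀ hK0, div_mul_eq_mul_div]
          refine hgk.trans ?_
          have := hTpos k
          gcongr; linarith)
  rw [Summable.tsum_add (((summable_nat_add_iff 1).2 hW).mul_left 4) (hE.mul_left D),
    tsum_mul_left, tsum_mul_left] at hble
  have hshift : ∑' k, (√(g (k + 1)) - 1) ^ 2 * μ.real {k + 1} ≤
      ∑' k, (√(g k) - 1) ^ 2 * μ.real {k} := by
    rw [hW.tsum_eq_zero_add]
    have : 0 ≤ (√(g 0) - 1) ^ 2 * μ.real {0} := by positivity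
    linarith
  have hone : HasSum (fun k => μ.real {k}) 1 := by
    have hi : Integrable (fun _ : ℕ => (1 : ℝ)) μ := integrable_const _
    have h2 := (integrable_iff_summable_real μ).1 hi
    have h3 := integral_eq_tsum_real μ hi
    simp only [one_mul, integral_const, probReal_univ, smul_eq_mul, mul_one] at h2 h3
    rw [h3]; exact h2.hasSum
  have hφ (k : ℕ) : (g k * Real.log (g k) - g k + 1) * μ.real {k} ≤
      M * ((√(g k) - 1) ^ 2 * μ.real {k}) + g k * Real.posLog (g k / K) * μ.real {k} := by
    have := mul_le_mul_of_nonneg_right (mul_log_sub_le_of_le (hg k) (by linarith : 4 ≤ K))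
      (hmpos k).le
    rw [← hM] at this
    linarith
  -- Nonnegativity of g log g - g + 1 gives summability by comparison, so integrability of g log g
  -- is a conclusion and not an assumption.
  have hφ0 (k : ℕ) : 0 ≤ (g k * Real.log (g k) - g k + 1) * μ.real {k} := by
    apply mul_nonneg _ (hmpos k).le
    have h2 := mul_le_mul_of_nonneg_left (Real.one_sub_inv_le_log_of_pos (hg k)) (hg k).le
    rw [mul_sub, mul_inv_cancel₀ (hg k).ne'] at h2
    linarith
  have hφs : Summable fun k => (g k * Real.log (g k) - g k + 1) * μ.real {k} :=
    Summable.of_nonneg_of_le hφ0 hφ ((hW.mul_left M).add hbs)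
  have hφle := hφs.tsum_le_tsum hφ ((hW.mul_left M).add hbs)
  rw [Summable.tsum_add (hW.mul_left M) hbs, tsum_mul_left] at hφle
  have hent : HasSum (fun k => g k * Real.log (g k) * μ.real {k})
      (∑' k, (g k * Real.log (g k) - g k + 1) * μ.real {k} + 1 - 1) := by
    have h2 := (hφs.hasSum.add (h1 ▸ hgs.hasSum)).sub hone
    refine h2.congr_fun ?_
    intro k; ring
  have hI : Integrable (fun k => g k * Real.log (g k)) μ :=
    (integrable_iff_summable_real μ).2 hent.summable
  refine ⟨hI, ?_⟩
  rw [integral_eq_tsum_real μ hI, hent.tsum_eq]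
  have h3 : M * ∑' k, (√(g k) - 1) ^ 2 * μ.real {k} ≤
    M * (CP / c * ∑' k, energyTerm μ p g k) := by gcongr
  linarith

/-- The entropy bound for positive functions of arbitrary mass. -/
lemma exists_Ent_le {p : ℝ} (hp0 : 0 < p) (hp1 : p ≤ 1) {μ : Measure ℕ}
    [IsProbabilityMeasure μ] (hμ : ∀ k : ℕ, 0 < μ {k}) {CP : ℝ} (hCP : 0 < CP)
    (hP : Poincare μ CP)
    (hbdd : BddAbove ((fun n : ℕ => (H p (tail μ (n - 1) / tail μ n))⁻¹ *
      Real.log (2 / tail μ n)) '' Set.Ici 1)) :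
    ∃ C : ℝ, 0 < C ∧ ∀ g : ℕ → ℝ, (∀ k, 0 < g k) → Integrable g μ →
      Summable (energyTerm μ p g) → Ent μ g ≤ C * ∑' k, energyTerm μ p g k := by
  obtain ⟨C, hC, h⟩ := exists_integral_mul_log_le hp0 hp1 hμ hCP hP hbdd
  refine ⟨C, hC, fun g hg hint hE => ?_⟩
  set m := ∫ k, g k ∂μ with hm
  have hm0 : 0 < m := by
    rw [hm, integral_eq_tsum_real μ hint]
    exact ((integrable_iff_summable_real μ).1 hint).tsum_pos
      (fun k => mul_nonneg (hg k).le measureReal_nonneg) 0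
      (mul_pos (hg 0) (real_singleton_pos hμ 0))
  -- Energy and entropy are both homogeneous of degree one, so normalizing the mass loses nothing.
  have hterm : energyTerm μ p (fun k => m⁻¹ * g k) = fun k => m⁻¹ * energyTerm μ p g k := by
    funext k
    have := (hg k).ne'
    rw [energyTerm, energyTerm, mul_div_mul_left _ _ (by positivity)]
    ring
  obtain ⟨hI, hle⟩ := h (fun k => m⁻¹ * g k) (fun k => mul_pos (by positivity) (hg k))
    (hint.const_mul _) (by rw [integral_const_mul, ← hm, inv_mul_cancel₀ hm0.ne'])
    (by rw [hterm]; exact hE.mul_left _)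
  rw [hterm, tsum_mul_left] at hle
  have hglog (k : ℕ) : g k * Real.log (g k) =
      m * (m⁻¹ * g k * Real.log (m⁻¹ * g k)) + Real.log m * g k := by
    rw [Real.log_mul (by positivity) (hg k).ne', Real.log_inv]
    field_simp
    ring
  rw [Ent, ← hm]
  simp_rw [hglog]
  rw [integral_add (hI.const_mul m) (hint.const_mul _), integral_const_mul, integral_const_mul,
    ← hm]
  have h2 := mul_le_mul_of_nonneg_left hle hm0.le
  have h3 : m * (C * (m⁻¹ * ∑' k, energyTerm μ p g k)) = C * ∑' k, energyTerm μ p g k := by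
    field_simp
  linarith

/-! ### Sufficiency: from g back to f -/

lemma summable_form_of_dom {μ : Measure ℕ} {f g : ℕ → ℝ} (hf : Dom μ f) (hg : Dom μ g) :
    Summable fun k => fwd f k * fwd g k * μ.real {k} := by
  refine Summable.of_norm_bounded (hf.2.add hg.2) fun k => ?_
  rw [Real.norm_eq_abs, abs_mul, abs_of_nonneg (measureReal_nonneg (μ := μ)), ← add_mul]
  apply mul_le_mul_of_nonneg_right _ measureReal_nonneg
  rw [abs_le]
  constructor <;> nlinarith [sq_nonneg (fwd f k + fwd g k), sq_nonneg (fwd f k - fwd g k),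
    sq_nonneg (fwd f k), sq_nonneg (fwd g k)]

lemma energyTerm_one (μ : Measure ℕ) {f : ℕ → ℝ} (hf : ∀ k, 0 < f k) (k : ℕ) :
    energyTerm μ 1 f k = fwd f k * fwd (fun k => Real.log (f k)) k * μ.real {k} := by
  have := (hf k).ne'
  rw [energyTerm, H_one, Real.log_div (hf _).ne' this, fwd, fwd]
  field_simp

lemma energyTerm_rpow (μ : Measure ℕ) {p : ℝ} (hp0 : 0 < p) (hp1 : p < 1) {f : ℕ → ℝ}
    (hf : ∀ k, 0 < f k) (k : ℕ) :
    energyTerm μ p (fun k => f k ^ p) k =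
      p ^ 2 / (p - 1) * (fwd (fun k => f k ^ (p - 1)) k * fwd f k * μ.real {k}) := by
  rw [energyTerm, ← H_two_point hp0 hp1 (hf k) (hf (k + 1)), fwd, fwd]
  ring

theorem exists_logSobolev {p : ℝ} (hp0 : 0 < p) (hp1 : p ≤ 1) {μ : Measure ℕ}
    [IsProbabilityMeasure μ] (hμ : ∀ k : ℕ, 0 < μ {k}) {CP : ℝ} (hCP : 0 < CP)
    (hP : Poincare μ CP)
    (hbdd : BddAbove ((fun n : ℕ => (H p (tail μ (n - 1) / tail μ n))⁻¹ *
      Real.log (2 / tail μ n)) '' Set.Ici 1)) :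
    ∃ C : ℝ, 0 < C ∧ LogSobolev μ p C := by
  obtain ⟨C, hC, h⟩ := exists_Ent_le hp0 hp1 hμ hCP hP hbdd
  refine ⟨4 * C, by positivity, ?_⟩
  rw [LogSobolev]
  split_ifs with hp
  · subst hp
    intro f hf hlf
    have hs := summable_form_of_dom hf.1 hlf
    have := h f hf.2 (hf.1.1.integrable one_le_two)
      (hs.congr fun k => (energyTerm_one μ hf.2 k).symm)
    refine this.trans (le_of_eq ?_)
    rw [form, tsum_congr (energyTerm_one μ hf.2)]
    ring
  · intro f hf hlf
    have hp1' := lt_of_le_of_ne hp1 hp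
    have hs := (summable_form_of_dom hlf.1 hf.1).mul_left (p ^ 2 / (p - 1))
    have hI : Integrable (fun k => f k ^ p) μ := by
      refine Integrable.mono' ((hf.1.1.integrable one_le_two).add (integrable_const 1))
        (measurable_of_countable _).aestronglyMeasurable (ae_of_all _ fun k => ?_)
      have hfk := hf.2 k
      rw [Real.norm_of_nonneg (by positivity)]
      simp only [Pi.add_apply]
      rcases le_total (f k) 1 with h1 | h1
      · linarith [Real.rpow_le_one hfk.le h1 hp0.le]
      · have := Real.rpow_le_rpow_of_exponent_le h1 hp1
        rw [Real.rpow_one] at this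
        linarith
    have := h (fun k => f k ^ p) (fun k => Real.rpow_pos_of_pos (hf.2 k) _) hI
      (hs.congr fun k => (energyTerm_rpow μ hp0 hp1' hf.2 k).symm)
    refine this.trans (le_of_eq ?_)
    rw [form, tsum_congr (energyTerm_rpow μ hp0 hp1' hf.2), tsum_mul_left]
    have : p - 1 ≠ 0 := by linarith
    field_simp

/-! ### Necessity: step functions as test functions -/

/-- The number of the times `σ 1, …, σ n` that are at most `k`. -/
def stepCount (σ : ℕ → ℕ) (n k : ℕ) : ℕ :=
  ((Finset.range n).filter fun j => σ (j + 1) ≤ k).card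

lemma stepCount_le (σ : ℕ → ℕ) (n k : ℕ) : stepCount σ n k ≤ n :=
  (Finset.card_filter_le _ _).trans (Finset.card_range n).le

/-- The times σ(j+1) ≤ k form an initial segment, so the sum telescopes; integration then only meets
tails. -/
lemma apply_stepCount {σ : ℕ → ℕ} (hσ : StrictMono σ) (F : ℕ → ℝ) (n k : ℕ) :
    F (stepCount σ n k) =
      F 0 + ∑ j ∈ Finset.range n, if σ (j + 1) ≤ k then F (j + 1) - F j else 0 := by
  induction n with
  | zero => simp [stepCount]
  | succ n ih =>
    rw [Finset.sum_range_succ, ← add_assoc, ← ih]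
    by_cases h : σ (n + 1) ≤ k
    · have hall (m : ℕ) (hm : m ≤ n + 1) : stepCount σ m k = m := by
        rw [stepCount, Finset.filter_true_of_mem, Finset.card_range]
        intro j hj
        rw [Finset.mem_range] at hj
        exact (hσ.monotone (by omega)).trans h
      rw [if_pos h, hall n n.le_succ, hall (n + 1) le_rfl]; ring
    · rw [if_neg h, add_zero, stepCount, stepCount, Finset.range_add_one,
        Finset.filter_insert, if_neg h]

lemma integral_apply_stepCount (μ : Measure ℕ) [IsProbabilityMeasure μ] {σ : ℕ → ℕ}
    (hσ : StrictMono σ) (F : ℕ → ℝ) (n : ℕ) :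
    ∫ k, F (stepCount σ n k) ∂μ =
      F 0 + ∑ j ∈ Finset.range n, (F (j + 1) - F j) * tail μ (σ (j + 1)) := by
  simp_rw [apply_stepCount hσ F n]
  have e (j : ℕ) : (fun k => if σ (j + 1) ≤ k then F (j + 1) - F j else 0) =
      (Set.Ici (σ (j + 1))).indicator fun _ => F (j + 1) - F j := by
    funext k; simp [Set.indicator_apply]
  have hI (j : ℕ) : Integrable (fun k => if σ (j + 1) ≤ k then F (j + 1) - F j else 0) μ := by
    rw [e]; exact (integrable_const _).indicator measurableSet_Ici
  rw [integral_add (integrable_const _) (integrable_finsetSum _ fun j _ => hI j),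
    integral_finsetSum _ fun j _ => hI j]
  congr 1
  · simp
  · refine Finset.sum_congr rfl fun j _ => ?_
    rw [e, integral_indicator measurableSet_Ici, setIntegral_const, smul_eq_mul, mul_comm]
    rfl

/-- Each jump is seen only from k = σ(j+1) - 1, and injectivity of σ removes the cross terms. -/
lemma fwd_mul_fwd_stepCount {σ : ℕ → ℕ} (hσ : StrictMono σ) (F G : ℕ → ℝ) (n k : ℕ) :
    fwd (fun k => F (stepCount σ n k)) k * fwd (fun k => G (stepCount σ n k)) k =
      ∑ j ∈ Finset.range n,
        if k = σ (j + 1) - 1 then (F (j + 1) - F j) * (G (j + 1) - G j) else 0 := by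
  -- Positivity makes the truncated subtraction σ(j+1) - 1 genuine.
  have hpos (j : ℕ) : 0 < σ (j + 1) := (Nat.zero_le _).trans_lt (hσ j.lt_succ_self)
  have hfwd (F : ℕ → ℝ) : fwd (fun k => F (stepCount σ n k)) k =
      ∑ j ∈ Finset.range n, if k = σ (j + 1) - 1 then F (j + 1) - F j else 0 := by
    rw [fwd, apply_stepCount hσ F, apply_stepCount hσ F, add_sub_add_left_eq_sub,
      ← Finset.sum_sub_distrib]
    refine Finset.sum_congr rfl fun j _ => ?_
    have := hpos j
    split_ifs <;> first | omega | simp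
  rw [hfwd, hfwd]
  by_cases h : ∃ i, k = σ (i + 1) - 1
  · obtain ⟨i, hi⟩ := h
    have key (j : ℕ) : k = σ (j + 1) - 1 ↔ i = j := by
      rw [hi]
      constructor
      · intro h
        have h1 := hpos i
        have h2 := hpos j
        have := hσ.injective (by omega : σ (i + 1) = σ (j + 1))
        omega
      · rintro rfl; rfl
    simp only [key, Finset.sum_ite_eq]
    split_ifs <;> simp
  · push Not at h
    simp [h]

lemma hasSum_form_stepCount (μ : Measure ℕ) {σ : ℕ → ℕ} (hσ : StrictMono σ) (F G : ℕ → ℝ)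
    (n : ℕ) :
    HasSum (fun k => fwd (fun k => F (stepCount σ n k)) k *
        fwd (fun k => G (stepCount σ n k)) k * μ.real {k})
      (∑ j ∈ Finset.range n,
        (F (j + 1) - F j) * (G (j + 1) - G j) * μ.real {σ (j + 1) - 1}) := by
  simp_rw [fwd_mul_fwd_stepCount hσ, Finset.sum_mul]
  refine hasSum_sum fun j _ => ?_
  have := hasSum_single (f := fun k => (if k = σ (j + 1) - 1 then
    (F (j + 1) - F j) * (G (j + 1) - G j) else 0) * μ.real {k}) (σ (j + 1) - 1)
    (fun k hk => by simp [hk])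
  simpa using this

lemma dom_stepCount (μ : Measure ℕ) [IsProbabilityMeasure μ] {σ : ℕ → ℕ} (hσ : StrictMono σ)
    (F : ℕ → ℝ) (n : ℕ) : Dom μ fun k => F (stepCount σ n k) := by
  refine ⟨MemLp.of_bound (measurable_of_countable _).aestronglyMeasurable
    (∑ i ∈ Finset.range (n + 1), |F i|) (ae_of_all _ fun k => ?_), ?_⟩
  · exact Finset.single_le_sum (f := fun i => |F i|) (fun i _ => abs_nonneg _)
      (Finset.mem_range.2 (Nat.lt_succ_of_le (stepCount_le σ n k)))
  · simpa [sq] using (hasSum_form_stepCount μ hσ F F n).summable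

/-- The `p`-log-Sobolev inequality tested on step functions. -/
lemma LogSobolev.Ent_stepCount_le {μ : Measure ℕ} [IsProbabilityMeasure μ] {p C : ℝ}
    (hp0 : 0 < p) (hp1 : p ≤ 1) (h : LogSobolev μ p C) {σ : ℕ → ℕ} (hσ : StrictMono σ)
    {u : ℕ → ℝ} (hu : ∀ j, 0 < u j) (n : ℕ) :
    Ent μ (fun k => u (stepCount σ n k)) ≤
      C / 4 * ∑ j ∈ Finset.range n, u j * H p (u (j + 1) / u j) * μ.real {σ (j + 1) - 1} := by
  rw [LogSobolev] at h
  split_ifs at h with hp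
  · subst hp
    refine (h _ ⟨dom_stepCount μ hσ u n, fun k => hu _⟩
      (dom_stepCount μ hσ (fun j => Real.log (u j)) n)).trans (le_of_eq ?_)
    rw [form, (hasSum_form_stepCount μ hσ u (fun j => Real.log (u j)) n).tsum_eq]
    refine congrArg _ (Finset.sum_congr rfl fun j _ => ?_)
    have := (hu j).ne'
    rw [H_one, Real.log_div (hu _).ne' this]
    field_simp
  · have hp1' := lt_of_le_of_ne hp1 hp
    set F : ℕ → ℝ := fun j => u j ^ (1 / p) with hF
    have hF0 (j : ℕ) : 0 < F j := Real.rpow_pos_of_pos (hu j) _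
    have hFp (j : ℕ) : F j ^ p = u j := by
      rw [hF, ← Real.rpow_mul (hu j).le, one_div_mul_cancel hp0.ne', Real.rpow_one]
    have := h (fun k => F (stepCount σ n k)) ⟨dom_stepCount μ hσ F n, fun k => hF0 _⟩
      ⟨dom_stepCount μ hσ (fun j => F j ^ (p - 1)) n, fun k => Real.rpow_pos_of_pos (hF0 _) _⟩
    simp only [hFp] at this
    refine this.trans (le_of_eq ?_)
    rw [form, (hasSum_form_stepCount μ hσ (fun j => F j ^ (p - 1)) F n).tsum_eq,
      Finset.mul_sum, Finset.mul_sum]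
    refine Finset.sum_congr rfl fun j _ => ?_
    rw [← hFp j, ← hFp (j + 1), ← H_two_point hp0 hp1' (hF0 j) (hF0 (j + 1))]
    have : p - 1 ≠ 0 := by linarith
    field_simp

/-! ### Necessity: halving tails and the contradiction -/

/-- Passing to a subsequence along which the tails halve at every step. -/
lemma exists_halving_subsequence {p : ℝ} (hp0 : 0 < p) (hp1 : p ≤ 1) {μ : Measure ℕ}
    [IsProbabilityMeasure μ] (hμ : ∀ k : ℕ, 0 < μ {k}) {C₀ ε : ℝ} (hC₀ : 0 < C₀)
    (hdbl : ∀ x y : ℝ, 1 ≤ x → 1 ≤ y → y ≤ 2 * x → H p y ≤ C₀ * (H p x + 1))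
    {τ : ℕ → ℕ} (hτ : StrictMono τ) {i₀ : ℕ}
    (h : ∀ i, i₀ ≤ i → H p (tail μ (τ i) / tail μ (τ (i + 1))) *
      (tail μ (τ (i + 1) - 1) / tail μ (τ i)) ≤ ε * Real.log (2 / tail μ (τ (i + 1)))) :
    ∃ σ : ℕ → ℕ, StrictMono σ ∧ ∀ j, tail μ (σ (j + 1)) ≤ tail μ (σ j) / 2 ∧
      H p (tail μ (σ j) / tail μ (σ (j + 1))) * (tail μ (σ (j + 1) - 1) / tail μ (σ j)) ≤
        C₀ * (ε * Real.log (2 / tail μ (σ (j + 1))) + 1) := by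
  have hT := tail_pos hμ
  have hanti := tail_antitone μ
  have step (i : ℕ) : ∃ i', i < i' ∧ (i₀ ≤ i → tail μ (τ i') ≤ tail μ (τ i) / 2 ∧
      H p (tail μ (τ i) / tail μ (τ i')) * (tail μ (τ i' - 1) / tail μ (τ i)) ≤
        C₀ * (ε * Real.log (2 / tail μ (τ i')) + 1)) := by
    have hex : ∃ d, tail μ (τ (i + (d + 1))) ≤ tail μ (τ i) / 2 := by
      have ht := ((tendsto_tail μ).comp hτ.tendsto_atTop).eventually_le_const
        (half_pos (hT (τ i)))
      obtain ⟨N, hN⟩ := eventually_atTop.1 ht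
      exact ⟨N, hN _ (by omega)⟩
    classical
    -- Stopping at the first halving means the tail one step earlier was still above half, so the
    -- combined ratio is at most twice the last one and the doubling of H_p applies.
    set d := Nat.find hex with hd
    have hd1 : tail μ (τ (i + (d + 1))) ≤ tail μ (τ i) / 2 := Nat.find_spec hex
    have hd2 : tail μ (τ i) / 2 < tail μ (τ (i + d)) := by
      rcases Nat.eq_zero_or_pos d with h0 | h0
      · rw [h0, add_zero]; exact half_lt_self (hT _)
      · have := Nat.find_min hex (m := d - 1) (by omega)
        rwa [Nat.sub_add_cancel h0, not_le] at this
    refine ⟨i + (d + 1), by omega, fun hi => ⟨hd1, ?_⟩⟩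
    have hx := h (i + d) (by omega)
    rw [add_assoc] at hx
    have hprev : tail μ (τ (i + d)) ≤ tail μ (τ i) := hanti (hτ.monotone (by omega))
    have hnext : tail μ (τ (i + (d + 1))) ≤ tail μ (τ (i + d)) :=
      hanti (hτ.monotone (by omega))
    have hpred : tail μ (τ (i + (d + 1)) - 1) ≤ tail μ (τ (i + d)) := by
      have : τ (i + d) < τ (i + (d + 1)) := hτ (by omega)
      exact hanti (by omega)
    have t0 := hT (τ i)
    have t1 := hT (τ (i + d))
    have t2 := hT (τ (i + (d + 1)))
    have t3 := hT (τ (i + (d + 1)) - 1)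
    set a := tail μ (τ i)
    set b := tail μ (τ (i + d))
    set c := tail μ (τ (i + (d + 1)))
    set e := tail μ (τ (i + (d + 1)) - 1)
    have hx1 : 1 ≤ b / c := by rwa [one_le_div t2]
    have hy := hdbl (b / c) (a / c) hx1 (by rw [one_le_div t2]; linarith)
      (by rw [← mul_div_assoc]; gcongr; linarith)
    have hH := H_nonneg_of_one_le hp0 hp1 hx1
    have hea : e / a ≤ e / b := by gcongr
    have hea1 : e / a ≤ 1 := by rw [div_le_one t0]; linarith
    calc H p (a / c) * (e / a) ≤ C₀ * (H p (b / c) + 1) * (e / a) := by gcongr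
      _ = C₀ * (H p (b / c) * (e / a) + e / a) := by ring
      _ ≤ C₀ * (H p (b / c) * (e / b) + 1) := by gcongr
      _ ≤ _ := by gcongr
  choose next hnext hprop using step
  have hge (j : ℕ) : i₀ ≤ next^[j] i₀ := by
    induction j with
    | zero => exact le_rfl
    | succ j ih => rw [Function.iterate_succ_apply']; exact ih.trans (hnext _).le
  refine ⟨fun j => τ (next^[j] i₀), strictMono_nat_of_lt_succ fun j => ?_, fun j => ?_⟩
  · rw [Function.iterate_succ_apply']; exact hτ (hnext _)
  · simp only [Function.iterate_succ_apply']; exact hprop _ (hge j)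

/-- The tangent bound log y ≤ y/128 + log 128, with y ≤ 2n, costs n²/32, half of the available
margin; the linear terms fit in the other half for large n. -/
lemma exists_quadratic_gt_mul_log (u D : ℝ) (hu : 1 ≤ u) :
    ∃ n : ℕ, (u + n) * Real.log (u + n) + D * n < (n : ℝ) ^ 2 / 16 := by
  set A := |Real.log 128| with hA
  obtain ⟨n, hn⟩ := exists_nat_gt (max u (32 * (2 * A + |D|)))
  have h1 : u < n := (le_max_left _ _).trans_lt hn
  have h2 : 32 * (2 * A + |D|) < n := (le_max_right _ _).trans_lt hn
  refine ⟨n, ?_⟩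
  have hy : 0 < u + n := by linarith
  have hlog : Real.log (u + n) ≤ (u + n) / 128 + A := by
    have h3 := Real.log_le_sub_one_of_pos (by positivity : 0 < (u + n) / 128)
    rw [Real.log_div hy.ne' (by norm_num)] at h3
    linarith [le_abs_self (Real.log 128)]
  have hA0 : 0 ≤ A := abs_nonneg _
  have hn0 : (0 : ℝ) < n := by linarith
  calc (u + n) * Real.log (u + n) + D * n
      ≤ (u + n) * ((u + n) / 128 + A) + |D| * n := by gcongr; exact le_abs_self D
    _ ≤ (2 * n) * ((2 * n) / 128 + A) + |D| * n := by gcongr <;> linarith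
    _ = (n : ℝ) ^ 2 / 32 + (2 * A + |D|) * n := by ring
    _ < (n : ℝ) ^ 2 / 16 := by nlinarith

/-- Step functions with halving tails and small energy contradict the log-Sobolev inequality. -/
lemma LogSobolev.false_of_halving {μ : Measure ℕ} [IsProbabilityMeasure μ] {p C C₀ : ℝ}
    (hp0 : 0 < p) (hp1 : p ≤ 1) (hμ : ∀ k : ℕ, 0 < μ {k}) (hC : 0 < C) (hC₀ : 0 < C₀)
    (h : LogSobolev μ p C) {σ : ℕ → ℕ} (hσ : StrictMono σ)
    (hσT : ∀ j, tail μ (σ (j + 1)) ≤ tail μ (σ j) / 2)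
    (hσE : ∀ j, H p (tail μ (σ j) / tail μ (σ (j + 1))) *
      (tail μ (σ (j + 1) - 1) / tail μ (σ j)) ≤
        C₀ * (1 / (C * C₀) * Real.log (2 / tail μ (σ (j + 1))) + 1)) : False := by
  have hT := tail_pos hμ
  set u : ℕ → ℝ := fun j => (tail μ (σ j))⁻¹ with hu
  set ℓ : ℕ → ℝ := fun j => Real.log (u j) with hℓ
  have hu0 (j : ℕ) : 0 < u j := inv_pos.2 (hT _)
  have hu1 (j : ℕ) : 1 ≤ u j := (one_le_inv₀ (hT _)).2 (tail_le_one μ _)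
  have hudbl (j : ℕ) : 2 * u j ≤ u (j + 1) := by
    rw [hu]
    simp only
    rw [← div_eq_mul_inv, div_le_iff₀ (hT _), inv_mul_eq_div, le_div_iff₀ (hT _)]
    linarith [hσT j]
  have hℓ0 (j : ℕ) : 0 ≤ ℓ j := Real.log_nonneg (hu1 j)
  have hℓstep (j : ℕ) : ℓ j + Real.log 2 ≤ ℓ (j + 1) := by
    rw [add_comm, hℓ]
    simp only
    rw [← Real.log_mul two_ne_zero (hu0 j).ne']
    exact Real.log_le_log (mul_pos two_pos (hu0 j)) (hudbl j)
  have hl2 : 1 / 2 < Real.log 2 := by linarith [Real.log_two_gt_d9]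
  have hl21 : Real.log 2 < 1 := by linarith [Real.log_two_lt_d9]
  have huT (j : ℕ) : u (j + 1) * tail μ (σ (j + 1)) = 1 := inv_mul_cancel₀ (hT _).ne'
  have huT' (j : ℕ) : u j * tail μ (σ (j + 1)) ≤ 1 / 2 := by
    rw [hu]
    simp only
    rw [inv_mul_eq_div, div_le_iff₀ (hT _)]; linarith [hσT j]
  obtain ⟨n, hn⟩ := exists_quadratic_gt_mul_log (u 0) (1 / 4 + C * C₀ / 4) (hu1 0)
  set S := ∑ j ∈ Finset.range n, ℓ (j + 1) with hS
  -- Halving adds log 2 > 1/2 to ℓ at each step, so ℓ(j) ≥ j/2.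
  have hSge : (n : ℝ) ^ 2 / 4 ≤ S := by
    rw [hS]
    clear_value S
    clear hn hS
    induction n with
    | zero => simp
    | succ n ih =>
      have hl (j : ℕ) : (j : ℝ) / 2 ≤ ℓ j := by
        induction j with
        | zero => simpa using hℓ0 0
        | succ j ih => push_cast; linarith [hℓstep j]
      rw [Finset.sum_range_succ]
      have := hl (n + 1)
      push_cast at this ⊢
      nlinarith
  have hEnt := h.Ent_stepCount_le hp0 hp1 hσ hu0 n
  have hint1 := integral_apply_stepCount μ hσ u n
  have hint2 := integral_apply_stepCount μ hσ (fun j => u j * Real.log (u j)) n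
  rw [Ent, hint2, hint1] at hEnt
  have hmass : ∑ j ∈ Finset.range n, (u (j + 1) - u j) * tail μ (σ (j + 1)) ≤ n := by
    calc _ ≤ ∑ j ∈ Finset.range n, (1 : ℝ) := Finset.sum_le_sum fun j _ => by
          have := mul_pos (hu0 j) (hT (σ (j + 1)))
          linarith [huT j]
      _ = n := by simp
  have hmass0 : 0 ≤ ∑ j ∈ Finset.range n, (u (j + 1) - u j) * tail μ (σ (j + 1)) :=
    Finset.sum_nonneg fun j _ => by linarith [huT j, huT' j]
  -- Term j is at least ℓ(j+1) - ℓ(j)/2 ≥ ℓ(j+1)/2, because u(j+1) times the tail at σ(j+1) is 1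
  -- while u(j) times it is at most 1/2.
  have hent : S / 2 ≤ u 0 * Real.log (u 0) + ∑ j ∈ Finset.range n,
      (u (j + 1) * Real.log (u (j + 1)) - u j * Real.log (u j)) * tail μ (σ (j + 1)) := by
    rw [hS, Finset.sum_div]
    have h0 : 0 ≤ u 0 * Real.log (u 0) := mul_nonneg (hu0 0).le (hℓ0 0)
    refine le_trans (Finset.sum_le_sum fun j _ => ?_) (le_add_of_nonneg_left h0)
    have e : (u (j + 1) * Real.log (u (j + 1)) - u j * Real.log (u j)) * tail μ (σ (j + 1)) =
        u (j + 1) * tail μ (σ (j + 1)) * ℓ (j + 1) - u j * tail μ (σ (j + 1)) * ℓ j := by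
      rw [hℓ]; ring
    rw [e, huT]
    have := mul_le_mul_of_nonneg_right (huT' j) (hℓ0 j)
    linarith [hℓstep j]
  have hlogmass : (u 0 + ∑ j ∈ Finset.range n, (u (j + 1) - u j) * tail μ (σ (j + 1))) *
      Real.log (u 0 + ∑ j ∈ Finset.range n, (u (j + 1) - u j) * tail μ (σ (j + 1))) ≤
      (u 0 + n) * Real.log (u 0 + n) := by
    have h1 := hu1 0
    have hn0 : (0 : ℝ) ≤ n := n.cast_nonneg
    apply mul_le_mul
    · linarith
    · apply Real.log_le_log <;> linarith
    · apply Real.log_nonneg; linarith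
    · linarith
  have henergy : ∑ j ∈ Finset.range n, u j * H p (u (j + 1) / u j) * μ.real {σ (j + 1) - 1} ≤
      C₀ * (1 / (C * C₀) * (S + n) + n) := by
    have e : C₀ * (1 / (C * C₀) * (S + n) + n) =
        ∑ j ∈ Finset.range n, C₀ * (1 / (C * C₀) * (ℓ (j + 1) + 1) + 1) := by
      rw [← Finset.mul_sum, Finset.sum_add_distrib, ← Finset.mul_sum, Finset.sum_add_distrib]
      simp [hS]
    rw [e]
    refine Finset.sum_le_sum fun j _ => ?_
    have e1 : u (j + 1) / u j = tail μ (σ j) / tail μ (σ (j + 1)) := by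
      rw [hu]; simp only; rw [inv_div_inv]
    have hH : 0 ≤ H p (tail μ (σ j) / tail μ (σ (j + 1))) :=
      H_nonneg hp0 hp1 (div_pos (hT _) (hT _))
    have hm : μ.real {σ (j + 1) - 1} ≤ tail μ (σ (j + 1) - 1) := by
      have := hT (σ (j + 1) - 1 + 1)
      linarith [tail_sub_tail_succ μ (σ (j + 1) - 1)]
    have e2 : Real.log (2 / tail μ (σ (j + 1))) = Real.log 2 + ℓ (j + 1) := by
      rw [div_eq_mul_inv, Real.log_mul two_ne_zero (hu0 (j + 1)).ne']
    calc u j * H p (u (j + 1) / u j) * μ.real {σ (j + 1) - 1}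
        ≤ u j * H p (u (j + 1) / u j) * tail μ (σ (j + 1) - 1) := by
          rw [e1]
          exact mul_le_mul_of_nonneg_left hm (mul_nonneg (hu0 j).le hH)
      _ = H p (tail μ (σ j) / tail μ (σ (j + 1))) *
          (tail μ (σ (j + 1) - 1) / tail μ (σ j)) := by
        rw [e1, hu]; simp only; rw [div_eq_mul_inv (tail μ (σ (j + 1) - 1))]; ring
      _ ≤ _ := hσE j
      _ ≤ _ := by
        rw [e2, add_comm (Real.log 2)]
        gcongr
  -- The factor 1/(C C₀) was chosen to leave exactly S/4 here. Against the entropy's S/2, the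
  -- surplus S/4 ≥ n²/16 contradicts the choice of n.
  have h4 : C / 4 * (C₀ * (1 / (C * C₀) * (S + n) + n)) =
      S / 4 + (1 / 4 + C * C₀ / 4) * n := by
    field_simp; ring
  have h5 := mul_le_mul_of_nonneg_left henergy (by positivity : 0 ≤ C / 4)
  rw [h4] at h5
  linarith

theorem not_logSobolev {p : ℝ} (hp0 : 0 < p) (hp1 : p ≤ 1) {μ : Measure ℕ}
    [IsProbabilityMeasure μ] (hμ : ∀ k : ℕ, 0 < μ {k}) {τ : ℕ → ℕ} (hτ : StrictMono τ)
    (hlim : Tendsto (fun n : ℕ =>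
        (H p (tail μ (τ (n - 1)) / tail μ (τ n)))⁻¹ *
          (tail μ (τ (n - 1)) / tail μ (τ n - 1)) *
          Real.log (2 / tail μ (τ n))) atTop atTop) {C : ℝ} (hC : 0 < C) :
    ¬ LogSobolev μ p C := by
  intro h
  obtain ⟨C₀, hC₀, hdbl⟩ := exists_H_le_of_le_two_mul hp0 hp1
  obtain ⟨i₀, hi₀⟩ := eventually_atTop.1 (hlim.eventually_ge_atTop (C * C₀))
  obtain ⟨σ, hσ, hprop⟩ := exists_halving_subsequence hp0 hp1 hμ (ε := 1 / (C * C₀)) hC₀ hdbl hτ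
    (i₀ := i₀) (fun i hi => by
      have h1 := hi₀ (i + 1) (by omega)
      rw [Nat.add_sub_cancel] at h1
      have t0 := tail_pos hμ (τ i)
      have t1 := tail_pos hμ (τ (i + 1))
      have t2 := tail_pos hμ (τ (i + 1) - 1)
      have hH : 0 < H p (tail μ (τ i) / tail μ (τ (i + 1))) := by
        apply H_pos hp0 hp1
        rw [one_lt_div t1]
        exact tail_strictAnti hμ (hτ i.lt_succ_self)
      rw [one_div, le_inv_mul_iff₀ (by positivity)]
      calc _ ≤ (H p (tail μ (τ i) / tail μ (τ (i + 1))))⁻¹ *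
            (tail μ (τ i) / tail μ (τ (i + 1) - 1)) * Real.log (2 / tail μ (τ (i + 1))) *
            (H p (tail μ (τ i) / tail μ (τ (i + 1))) *
              (tail μ (τ (i + 1) - 1) / tail μ (τ i))) := by gcongr
        _ = _ := by field_simp)
  exact h.false_of_halving hp0 hp1 hμ hC hC₀ hσ (fun j => (hprop j).1) (fun j => (hprop j).2)

end BirthDeath

theorem theoremT (p : ℝ) (hp0 : 0 < p) (hp1 : p ≤ 1)
    (μ : MeasureTheory.Measure ℕ) [MeasureTheory.IsProbabilityMeasure μ]
    (hμ : ∀ k : ℕ, 0 < μ {k}) :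
    ((∃ C : ℝ, 0 < C ∧ BirthDeath.Poincare μ C) →
      BddAbove ((fun n : ℕ =>
        (BirthDeath.H p (BirthDeath.tail μ (n - 1) / BirthDeath.tail μ n))⁻¹ *
          Real.log (2 / BirthDeath.tail μ n)) '' Set.Ici 1) →
      ∃ C : ℝ, 0 < C ∧ BirthDeath.LogSobolev μ p C) ∧
    ((∃ τ : ℕ → ℕ, StrictMono τ ∧
      Filter.Tendsto (fun n : ℕ =>
        (BirthDeath.H p (BirthDeath.tail μ (τ (n - 1)) / BirthDeath.tail μ (τ n)))⁻¹ *
          (BirthDeath.tail μ (τ (n - 1)) / BirthDeath.tail μ (τ n - 1)) *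
          Real.log (2 / BirthDeath.tail μ (τ n))) Filter.atTop Filter.atTop) →
      ∀ C : ℝ, 0 < C → ¬ BirthDeath.LogSobolev μ p C) := by
  refine ⟨?_, ?_⟩
  · rintro ⟨CP, hCP, hP⟩ hbdd
    exact BirthDeath.exists_logSobolev hp0 hp1 hμ hCP hP hbdd
  · rintro ⟨τ, hτ, hlim⟩ C hC
    exact BirthDeath.not_logSobolev hp0 hp1 hμ hτ hlim hC
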